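/- Let $H$ be an infinite-dimensional complex Hilbert space. For a bounded operator $T$ on $H$ put $s_n(T)=\inf\{\|T-F\|:\operatorname{rank}F\le n\}$, $n\ge0$, and let $\|T\|_{S_p}=\big(\sum_{n\ge0}s_n(T)^p\big)^{1/p}$ for $1\le p<\infty$ and $\|T\|_{S_\infty}=\|T\|$. For finite rank self-adjoint operators $A,B,C$ on $H$ and a function $f:\mathbb R^3\to\mathbb C$ put $$f(A,B,C)=\sum_{\lambda\in\sigma(A),\,\mu\in\sigma(B),\,\nu\in\sigma(C)}f(\lambda,\mu,\nu)\,E_A(\{\lambda\})E_B(\{\mu\})E_C(\{\nu\}),$$ where $E_A$, $E_B$, $E_C$ are the spectral measures of $A$, $B$, $C$. Let $w\in C^\infty(\mathbb R)$ satisfy $w\ge0$, $\operatorname{supp}w\subset[\frac12,2]$ and $w(s)=1-w(s/2)$ for $s\in[1,2]$, and for $n\in\mathbb Z$ let $W_n$ be the Schwartz function on $\mathbb R^d$ with $\int_{\mathbb R^d}W_n(x)e^{-i(x,t)}\,dx=w(2^{-n}\|t\|_2)$ for all $t\in\mathbb R^d$. For a tempered distribution $f$ on $\mathbb R^d$ let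 $f_n=f*W_n$ and $$\|f\|_{B^1_{\infty,1}(\mathbb R^d)}=\sum_{n\in\mathbb Z}2^n\|f_n\|_{L^\infty}.$$ The class $B^1_{\infty,1}(\mathbb R^d)$ consists of the tempered distributions $f$ for which this sum is finite and $\frac{\partial f}{\partial x_j}=\sum_{n\in\mathbb Z}\frac{\partial f_n}{\partial x_j}$ in the weak-$*$ topology of $\mathscr S'(\mathbb R^d)$ for $1\le j\le d$; its elements are continuous functions. Theorem. Let $p\in[1,\infty]$. There is no constant $K>0$ such that $$\|f(A_1,B_1,C_1)-f(A_2,B_2,C_2)\|_{S_p}\le K\,\|f\|_{B^1_{\infty,1}(\mathbb R^3)}\max\big\{\|A_1-A_2\|_{S_p},\|B_1-B_2\|_{S_p},\|C_1-C_2\|_{S_p}\big\}$$ for all triples $(A_1,B_1,C_1)$ and $(A_2,B_2,C_2)$ of not necessarily commuting finite rank self-adjoint operators on $H$ and all functions $f$ in $B^1_{\infty,1}(\mathbb R^3)$. -/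

import Mathlib

open MeasureTheory
open scoped ENNReal SchwartzMap ContDiff FourierTransform LineDeriv

noncomputable section

namespace TripleLip

/-! ### Schatten–von Neumann norms -/

section Operators

variable {H : Type*} [NormedAddCommGroup H] [InnerProductSpace ℂ H]

/-- The `n`-th singular value (`n = 0, 1, …`) of a bounded operator on a Hilbert space: the distance
in operator norm from `T` to the operators of rank at most `n`. -/
def singularValue (T : H →L[ℂ] H) (n : ℕ) : ℝ≥0∞ :=
  ⨅ (F : H →L[ℂ] H) (_ : LinearMap.rank (F : H →ₗ[ℂ] H) ≤ (n : Cardinal)), ‖T - F‖ₑ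

/-- The norm of the Schatten–von Neumann class `S_p`: the `ℓ^p` norm of the sequence of singular
values for `p < ∞`, and the operator norm for `p = ∞`. -/
def schattenNorm (p : ℝ≥0∞) (T : H →L[ℂ] H) : ℝ≥0∞ :=
  if p = ⊤ then ‖T‖ₑ else (∑' n, singularValue T n ^ p.toReal) ^ (1 / p.toReal)

variable [CompleteSpace H]

/-- Finite rank self-adjoint operators. -/
structure IsFiniteRankSelfAdjoint (A : H →L[ℂ] H) : Prop where
  isSelfAdjoint : IsSelfAdjoint A
  finiteRank : FiniteDimensional ℂ (LinearMap.range (A : H →ₗ[ℂ] H))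

/-- The value `E_A({a})` of the spectral measure of a self-adjoint operator `A` at a one-point set:
the orthogonal projection onto `ker (A - a I)`. -/
def spectralProj (A : H →L[ℂ] H) (a : ℝ) : H →L[ℂ] H :=
  (A - (a : ℂ) • (1 : H →L[ℂ] H)).ker.starProjection

/-- `f(A, B, C) = ∑ f(a, b, c) E_A({a}) E_B({b}) E_C({c})`, the sum being over `a ∈ σ(A)`,
`b ∈ σ(B)`, `c ∈ σ(C)`, for self-adjoint operators with finite spectra. -/
def tripleFun (f : EuclideanSpace ℝ (Fin 3) → ℂ) (A B C : H →L[ℂ] H) : H →L[ℂ] H :=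
  ∑ᶠ (a ∈ spectrum ℝ A) (b ∈ spectrum ℝ B) (c ∈ spectrum ℝ C),
    f !₂[a, b, c] • (spectralProj A a * spectralProj B b * spectralProj C c)

end Operators

/-! ### The Besov class `B^1_{∞,1}(ℝ^d)` -/

/-- The functions `w` generating a Littlewood–Paley decomposition. -/
structure DyadicBump where
  w : ℝ → ℝ
  smooth : ContDiff ℝ ∞ w
  nonneg : ∀ s, 0 ≤ w s
  supp : tsupport w ⊆ Set.Icc (1 / 2) 2
  partition : ∀ s ∈ Set.Icc (1 : ℝ) 2, w s = 1 - w (s / 2)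

instance : Nonempty DyadicBump := by
  refine ⟨⟨fun s => Real.smoothTransition (2 - s) - Real.smoothTransition (2 - 2 * s),
    ?_, ?_, ?_, ?_⟩⟩
  · exact (Real.smoothTransition.contDiff.comp (by fun_prop)).sub
      (Real.smoothTransition.contDiff.comp (by fun_prop))
  · intro s
    rcases le_total s 0 with h | h
    · rw [Real.smoothTransition.one_of_one_le (by linarith),
        Real.smoothTransition.one_of_one_le (by linarith)]
      simp
    · exact sub_nonneg.2 (Real.smoothTransition.monotone (by linarith))
  · refine closure_minimal ?_ isClosed_Icc
    intro s hs
    by_contra hn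
    apply hs
    rw [Set.mem_Icc, not_and_or, not_le, not_le] at hn
    rcases hn with h | h
    · simp [Real.smoothTransition.one_of_one_le (show (1 : ℝ) ≤ 2 - s by linarith),
        Real.smoothTransition.one_of_one_le (show (1 : ℝ) ≤ 2 - 2 * s by linarith)]
    · simp [Real.smoothTransition.zero_of_nonpos (show 2 - s ≤ 0 by linarith),
        Real.smoothTransition.zero_of_nonpos (show 2 - 2 * s ≤ 0 by linarith)]
  · rintro s ⟨h1, h2⟩
    rw [Real.smoothTransition.zero_of_nonpos (show 2 - 2 * s ≤ 0 by linarith),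
      Real.smoothTransition.one_of_one_le (show (1 : ℝ) ≤ 2 - s / 2 by linarith),
      show 2 - 2 * (s / 2) = 2 - s by ring]
    ring

section Besov

variable {d : ℕ}

/-- `ξ ↦ w (‖2πξ‖ / 2^n)`. -/
def lpSymbolFun (w : DyadicBump) (n : ℤ) (ξ : EuclideanSpace ℝ (Fin d)) : ℂ :=
  (w.w (‖(2 * Real.pi) • ξ‖ / 2 ^ n) : ℂ)

theorem lpSymbolFun_contDiff (w : DyadicBump) (n : ℤ) :
    ContDiff ℝ ∞ (lpSymbolFun (d := d) w n) := by
  have h2 : (0 : ℝ) < 2 ^ n := by positivity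
  rw [contDiff_iff_contDiffAt]
  intro x
  by_cases hx : x = 0
  · have : lpSymbolFun (d := d) w n =ᶠ[nhds x] fun _ => 0 := by
      have hc : Continuous fun ξ : EuclideanSpace ℝ (Fin d) => ‖(2 * Real.pi) • ξ‖ / 2 ^ n := by
        fun_prop
      have : ∀ᶠ ξ in nhds x, ‖(2 * Real.pi) • ξ‖ / 2 ^ n < 1 / 2 :=
        hc.continuousAt.eventually_lt continuousAt_const (by simp [hx])
      filter_upwards [this] with ξ hξ
      have : w.w (‖(2 * Real.pi) • ξ‖ / 2 ^ n) = 0 :=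
        image_eq_zero_of_notMem_tsupport fun h => absurd (w.supp h).1 (not_le.2 hξ)
      simp [lpSymbolFun, this]
    exact contDiffAt_const.congr_of_eventuallyEq this
  · have hx' : (2 * Real.pi) • x ≠ 0 := smul_ne_zero (by positivity) hx
    have h1 : ContDiffAt ℝ ∞ (fun ξ : EuclideanSpace ℝ (Fin d) => ‖(2 * Real.pi) • ξ‖ / 2 ^ n) x :=
      (ContDiffAt.norm ℝ (f := fun ξ : EuclideanSpace ℝ (Fin d) => (2 * Real.pi) • ξ)
        (contDiff_const_smul (2 * Real.pi)).contDiffAt hx').div_const _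
    exact Complex.ofRealCLM.contDiff.contDiffAt.comp x (w.smooth.contDiffAt.comp x h1)

theorem lpSymbolFun_hasCompactSupport (w : DyadicBump) (n : ℤ) :
    HasCompactSupport (lpSymbolFun (d := d) w n) := by
  have h2 : (0 : ℝ) < 2 ^ n := by positivity
  refine HasCompactSupport.intro (isCompact_closedBall (0 : EuclideanSpace ℝ (Fin d)) (2 * 2 ^ n)) ?_
  intro ξ hξ
  have hξ' : 2 * 2 ^ n < ‖ξ‖ := by simpa using hξ
  have : w.w (‖(2 * Real.pi) • ξ‖ / 2 ^ n) = 0 := by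
    refine image_eq_zero_of_notMem_tsupport fun h => ?_
    have h3 := (div_le_iff₀ h2).1 (w.supp h).2
    rw [norm_smul, Real.norm_of_nonneg (by positivity)] at h3
    nlinarith [Real.pi_gt_three, norm_nonneg ξ]
  simp [lpSymbolFun, this]

/-- The Schwartz function `W_n` with `∫ W_n(x) e^{-i(x,t)} dx = w(‖t‖ / 2^n)`. Mathlib's Fourier
transform has the kernel `e^{-2πi(x,ξ)}`, so that `t = 2πξ`. -/
def lpKernel (w : DyadicBump) (n : ℤ) : 𝓢(EuclideanSpace ℝ (Fin d), ℂ) :=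
  𝓕⁻ ((lpSymbolFun_hasCompactSupport w n).toSchwartzMap (lpSymbolFun_contDiff w n))

/-- The convolution `T * W` of a tempered distribution with a Schwartz function:
`⟨T * W, u⟩ = ⟨T, W(-·) * u⟩`. -/
def distConv (T : 𝓢'(EuclideanSpace ℝ (Fin d), ℂ)) (W : 𝓢(EuclideanSpace ℝ (Fin d), ℂ)) :
    𝓢'(EuclideanSpace ℝ (Fin d), ℂ) :=
  ContinuousLinearMap.toPointwiseConvergenceCLM _ _ _ _
    ((show 𝓢(EuclideanSpace ℝ (Fin d), ℂ) →L[ℂ] ℂ from T) ∘L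
      SchwartzMap.convolution (ContinuousLinearMap.mul ℂ ℂ)
        (SchwartzMap.compCLMOfContinuousLinearEquiv ℂ
          (ContinuousLinearEquiv.neg ℝ : EuclideanSpace ℝ (Fin d) ≃L[ℝ] _) W))

/-- The `L^∞` norm of a tempered distribution, equal to `∞` if it is not given by an
`L^∞` function. -/
def linftyNorm (S : 𝓢'(EuclideanSpace ℝ (Fin d), ℂ)) : ℝ≥0∞ :=
  ⨅ (g : Lp ℂ (⊤ : ℝ≥0∞) (volume : Measure (EuclideanSpace ℝ (Fin d))))
    (_ : Lp.toTemperedDistribution g = S), ‖g‖ₑ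

/-- The (semi)norm of `B^1_{∞,1}(ℝ^d)`: `∑_{n ∈ ℤ} 2^n ‖T * W_n‖_{L^∞}`. -/
def besovNorm (w : DyadicBump) (T : 𝓢'(EuclideanSpace ℝ (Fin d), ℂ)) : ℝ≥0∞ :=
  ∑' n : ℤ, (2 : ℝ≥0∞) ^ n * linftyNorm (distConv T (lpKernel w n))

/-- The (modified homogeneous) Besov class `B^1_{∞,1}(ℝ^d)`. The topology of Mathlib's space of
tempered distributions is the weak-* topology. -/
structure MemBesov (w : DyadicBump) (T : 𝓢'(EuclideanSpace ℝ (Fin d), ℂ)) : Prop where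
  norm_ne_top : besovNorm w T ≠ ⊤
  hasSum_deriv : ∀ j : Fin d,
    HasSum (fun n : ℤ => ∂_{EuclideanSpace.single j (1 : ℝ)} (distConv T (lpKernel w n)))
      (∂_{EuclideanSpace.single j (1 : ℝ)} T)

/-- The continuous function `f` is (the continuous representative of) the tempered
distribution `T`. -/
structure IsContinuousRepr (f : EuclideanSpace ℝ (Fin d) → ℂ)
    (T : 𝓢'(EuclideanSpace ℝ (Fin d), ℂ)) : Prop where
  continuous : Continuous f
  integrable : ∀ u : 𝓢(EuclideanSpace ℝ (Fin d), ℂ), Integrable fun x => u x * f x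
  apply_eq : ∀ u : 𝓢(EuclideanSpace ℝ (Fin d), ℂ), T u = ∫ x, u x * f x

end Besov

end TripleLip

end

open TripleLip

/-!
The function `f` realizes a chirp on the grid `{0, …, M - 1}³`: it equals `e^{2πi((k - j)m - jk)/M}`
at `(j, m, k)` and vanishes where the middle coordinate is a half-integer. Interpolating with Fejér
kernels, which are nonnegative and sum to `1`, gives `|f| ≤ 1` with frequencies bounded
independently of `M`, hence a Besov norm bounded independently of `M`. Let `e` be an orthonormal
family indexed by `ℤ/M`, let `A = C` be diagonal in the normalized discrete Fourier transform of
`e`, let `B₁` be diagonal in `e`, both with eigenvalues `0, …, M - 1`, and let `B₂ = B₁ + 1/2` on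
the span of `e`. The phases of `f` cancel those of the two changes of basis, so `f(A, B₁, C)` is
`√M` times a partial isometry of rank `M` on the span of `e`, while `f(A, B₂, C)` vanishes there.
Thus the difference has `S_p` norm at least `√M · M^{1/p}`, against `½ M^{1/p}` for `B₁ - B₂`.
-/

noncomputable section

namespace TripleLip

/-! ### Singular values -/

section Schatten

variable {H : Type*} [NormedAddCommGroup H] [InnerProductSpace ℂ H]
variable {p : ℝ≥0∞} {T : H →L[ℂ] H}

theorem singularValue_le_enorm (T : H →L[ℂ] H) (n : ℕ) : singularValue T n ≤ ‖T‖ₑ :=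
  (iInf₂_le (0 : H →L[ℂ] H) (by simp)).trans (by simp)

theorem singularValue_eq_zero_of_rank_le {n : ℕ}
    (hT : LinearMap.rank (T : H →ₗ[ℂ] H) ≤ (n : Cardinal)) : singularValue T n = 0 :=
  le_antisymm ((iInf₂_le T hT).trans_eq (by simp [enorm_eq_nnnorm])) zero_le

theorem le_singularValue {V : Submodule ℂ H} {c : ℝ≥0∞}
    (hV : ∀ x ∈ V, c * ‖x‖ₑ ≤ ‖T x‖ₑ) {n : ℕ} (hn : n < Module.finrank ℂ V) :
    c ≤ singularValue T n := by
  refine le_iInf₂ fun F hF => ?_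
  have : Module.Finite ℂ V := Module.finite_of_finrank_pos (Nat.zero_lt_of_lt hn)
  have : Module.Finite ℂ (LinearMap.range (F : H →ₗ[ℂ] H)) :=
    Module.rank_lt_aleph0_iff.1 (hF.trans_lt Cardinal.natCast_lt_aleph0)
  obtain ⟨x, hx, hx0⟩ := (Submodule.ne_bot_iff _).1 <| LinearMap.ker_ne_bot_of_finrank_lt
    (f := (F : H →ₗ[ℂ] H).rangeRestrict ∘ₗ V.subtype)
    ((Module.finrank_le_of_rank_le hF).trans_lt hn)
  have hFx : F x = 0 := congrArg Subtype.val (LinearMap.mem_ker.1 hx)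
  have hle : c * ‖(x : H)‖ₑ ≤ ‖T - F‖ₑ * ‖(x : H)‖ₑ :=
    calc c * ‖(x : H)‖ₑ ≤ ‖T x‖ₑ := hV x x.2
      _ = ‖(T - F) x‖ₑ := by rw [sub_apply, hFx, sub_zero]
      _ ≤ ‖T - F‖ₑ * ‖(x : H)‖ₑ := (T - F).le_opENorm _
  exact (ENNReal.mul_le_mul_iff_left (by simpa using hx0) (by simp)).1 hle

theorem mul_rpow_rpow_one_div {c m : ℝ≥0∞} {r : ℝ} (hr : 0 < r) :
    (m * c ^ r) ^ (1 / r) = c * m ^ r⁻¹ := by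
  rw [one_div, ENNReal.mul_rpow_of_nonneg _ _ (by positivity), ENNReal.rpow_rpow_inv hr.ne',
    mul_comm]

theorem schattenNorm_le_of_rank_le (hp : p ≠ 0) {m : ℕ}
    (hT : LinearMap.rank (T : H →ₗ[ℂ] H) ≤ (m : Cardinal)) :
    schattenNorm p T ≤ ‖T‖ₑ * (m : ℝ≥0∞) ^ p.toReal⁻¹ := by
  unfold schattenNorm
  split_ifs with hp_top
  · simp [hp_top]
  have hr : 0 < p.toReal := ENNReal.toReal_pos hp hp_top
  rw [← mul_rpow_rpow_one_div hr]
  gcongr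
  calc ∑' n, singularValue T n ^ p.toReal
      = ∑ n ∈ Finset.range m, singularValue T n ^ p.toReal := by
        refine tsum_eq_sum fun n hn => ?_
        rw [singularValue_eq_zero_of_rank_le, ENNReal.zero_rpow_of_pos hr]
        exact hT.trans (by simpa using hn)
    _ ≤ ∑ _n ∈ Finset.range m, ‖T‖ₑ ^ p.toReal := by
        gcongr
        exact singularValue_le_enorm T _
    _ = m * ‖T‖ₑ ^ p.toReal := by simp

theorem schattenNorm_zero (hp : p ≠ 0) : schattenNorm p (0 : H →L[ℂ] H) = 0 :=
  le_antisymm ((schattenNorm_le_of_rank_le hp (m := 0) (by simp)).trans_eq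
    (by simp [enorm_eq_nnnorm])) zero_le

theorem le_schattenNorm (hp : p ≠ 0) {V : Submodule ℂ H} (hV0 : Module.finrank ℂ V ≠ 0)
    {c : ℝ≥0∞} (hV : ∀ x ∈ V, c * ‖x‖ₑ ≤ ‖T x‖ₑ) :
    c * (Module.finrank ℂ V : ℝ≥0∞) ^ p.toReal⁻¹ ≤ schattenNorm p T := by
  unfold schattenNorm
  split_ifs with hp_top
  · simpa [hp_top] using
      (le_singularValue hV (Nat.pos_of_ne_zero hV0)).trans (singularValue_le_enorm T 0)
  have hr : 0 < p.toReal := ENNReal.toReal_pos hp hp_top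
  rw [← mul_rpow_rpow_one_div hr]
  gcongr
  calc (Module.finrank ℂ V : ℝ≥0∞) * c ^ p.toReal
      = ∑ _n ∈ Finset.range (Module.finrank ℂ V), c ^ p.toReal := by simp
    _ ≤ ∑ n ∈ Finset.range (Module.finrank ℂ V), singularValue T n ^ p.toReal := by
        gcongr with n hn
        exact le_singularValue hV (Finset.mem_range.1 hn)
    _ ≤ ∑' n, singularValue T n ^ p.toReal := ENNReal.sum_le_tsum _

end Schatten

/-! ### Functions of three finite rank operators -/

section SpectralProj

variable {H : Type*} [NormedAddCommGroup H] [InnerProductSpace ℂ H]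
variable {A B C : H →L[ℂ] H}

theorem mem_ker_sub_smul_one {x : ℝ} {y : H} :
    y ∈ (A - (x : ℂ) • (1 : H →L[ℂ] H)).ker ↔ A y = (x : ℂ) • y := by
  simp [LinearMap.mem_ker, sub_eq_zero]

variable [CompleteSpace H]

theorem spectralProj_eq_zero_iff {x : ℝ} :
    spectralProj A x = 0 ↔ ∀ y, A y = (x : ℂ) • y → y = 0 := by
  constructor
  · intro h y hy
    rw [← Submodule.starProjection_eq_self_iff.2 (mem_ker_sub_smul_one.2 hy)]
    exact congrArg (· y) h
  · intro h
    ext y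
    exact h _ (mem_ker_sub_smul_one.1 (Submodule.starProjection_apply_mem _ y))

theorem spectralProj_apply_of_eigenvector (hA : IsSelfAdjoint A) {a : ℝ} {y : H}
    (hy : A y = (a : ℂ) • y) (x : ℝ) : spectralProj A x y = if x = a then y else 0 := by
  split_ifs with hx
  · exact Submodule.starProjection_eq_self_iff.2 (mem_ker_sub_smul_one.2 (hx ▸ hy))
  · refine (Submodule.starProjection_apply_eq_zero_iff _).2 fun z hz => ?_
    have hinner : (x : ℂ) * inner ℂ z y = a * inner ℂ z y :=
      calc (x : ℂ) * inner ℂ z y = inner ℂ (A z) y := by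
            rw [mem_ker_sub_smul_one.1 hz, inner_smul_left, Complex.conj_ofReal]
        _ = inner ℂ z (A y) := hA.isSymmetric z y
        _ = a * inner ℂ z y := by rw [hy, inner_smul_right]
    exact (mul_eq_mul_right_iff.1 hinner).resolve_left (by exact_mod_cast hx)

theorem spectralProj_eq_zero_of_notMem_spectrum {x : ℝ} (hx : x ∉ spectrum ℝ A) :
    spectralProj A x = 0 := by
  rw [spectralProj_eq_zero_iff]
  intro y hy
  obtain ⟨u, hu⟩ := spectrum.notMem_iff.1 hx
  have huy : (u : H →L[ℂ] H) y = 0 := by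
    simp [hu, Algebra.algebraMap_eq_smul_one, hy]
  calc y = ((↑u⁻¹ : H →L[ℂ] H) * u) y := by rw [u.inv_mul, one_apply_eq_self]
    _ = (↑u⁻¹ : H →L[ℂ] H) ((u : H →L[ℂ] H) y) := rfl
    _ = 0 := by rw [huy, map_zero]

theorem finite_support_spectralProj
    (hA : FiniteDimensional ℂ (LinearMap.range (A : H →ₗ[ℂ] H))) :
    (Function.support (spectralProj A)).Finite := by
  let A' : Module.End ℂ (LinearMap.range (A : H →ₗ[ℂ] H)) :=
    (A : H →ₗ[ℂ] H).restrict fun y _ => LinearMap.mem_range_self _ y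
  have hfin : ((↑) ⁻¹' {μ | A'.HasEigenvalue μ} : Set ℝ).Finite :=
    A'.finite_hasEigenvalue.preimage Complex.ofReal_injective.injOn
  refine (hfin.insert 0).subset fun x hx => or_iff_not_imp_left.2 fun hx0 => ?_
  rw [Function.mem_support, ne_eq, spectralProj_eq_zero_iff] at hx
  push Not at hx
  obtain ⟨y, hy, hy0⟩ := hx
  have hx0' : (x : ℂ) ≠ 0 := by exact_mod_cast hx0
  have hmem : y ∈ LinearMap.range (A : H →ₗ[ℂ] H) :=
    ⟨(x : ℂ)⁻¹ • y, by
      rw [map_smul, ContinuousLinearMap.coe_coe, hy, inv_smul_smul₀ hx0']⟩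
  refine Module.End.hasEigenvalue_of_hasEigenvector (x := ⟨y, hmem⟩)
    ⟨Module.End.mem_eigenspace_iff.2 (Subtype.ext hy), fun h => hy0 (congrArg Subtype.val h)⟩

theorem finsum_mem_spectrum_eq_sum {V : Type*} [AddCommMonoid V] {s : Finset ℝ}
    (hs : Function.support (spectralProj A) ⊆ s) {g : ℝ → V}
    (hg : ∀ x, spectralProj A x = 0 → g x = 0) :
    ∑ᶠ x ∈ spectrum ℝ A, g x = ∑ x ∈ s, g x := by
  refine finsum_mem_eq_sum_of_inter_support_eq g (Set.ext fun x => and_congr_left fun hx => ?_)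
  have hx : spectralProj A x ≠ 0 := fun h => hx (hg x h)
  exact iff_of_true (not_imp_comm.1 spectralProj_eq_zero_of_notMem_spectrum hx) (hs hx)

theorem tripleFun_eq_sum {s t r : Finset ℝ} (hs : Function.support (spectralProj A) ⊆ s)
    (ht : Function.support (spectralProj B) ⊆ t) (hr : Function.support (spectralProj C) ⊆ r)
    (f : EuclideanSpace ℝ (Fin 3) → ℂ) :
    tripleFun f A B C = ∑ x ∈ s, ∑ y ∈ t, ∑ z ∈ r,
      f !₂[x, y, z] • (spectralProj A x * spectralProj B y * spectralProj C z) := by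
  rw [tripleFun, finsum_mem_spectrum_eq_sum hs fun x hx => by simp [hx]]
  refine Finset.sum_congr rfl fun x _ => ?_
  rw [finsum_mem_spectrum_eq_sum ht fun y hy => by simp [hy]]
  refine Finset.sum_congr rfl fun y _ => ?_
  rw [finsum_mem_spectrum_eq_sum hr fun z hz => by simp [hz]]

theorem sum_apply_spectralProj_of_eigenvector {V : Type*} [AddCommMonoid V] [Module ℂ V]
    [TopologicalSpace V] (hA : IsSelfAdjoint A) {s : Finset ℝ}
    (hs : Function.support (spectralProj A) ⊆ s) {a : ℝ} {y : H} (hy : A y = (a : ℂ) • y)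
    (F : ℝ → H →L[ℂ] V) :
    ∑ x ∈ s, F x (spectralProj A x y) = F a y := by
  have hP := spectralProj_apply_of_eigenvector hA hy
  rw [Finset.sum_eq_single a, hP, if_pos rfl]
  · intro x _ hx
    rw [hP, if_neg hx, map_zero]
  · intro has
    have : spectralProj A a = 0 := Function.notMem_support.1 fun h => has (hs h)
    rw [this, zero_apply, map_zero]

theorem sum_apply_spectralProj_sum {V ι : Type*} [AddCommMonoid V] [Module ℂ V]
    [TopologicalSpace V] [Fintype ι] (hA : IsSelfAdjoint A) {s : Finset ℝ}
    (hs : Function.support (spectralProj A) ⊆ s) {u : ι → H} {a : ι → ℝ}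
    (hu : ∀ i, A (u i) = (a i : ℂ) • u i) (c : ι → ℂ) (F : ℝ → H →L[ℂ] V) :
    ∑ x ∈ s, F x (spectralProj A x (∑ i, c i • u i)) = ∑ i, c i • F (a i) (u i) := by
  simp only [map_sum, map_smul]
  rw [Finset.sum_comm]
  refine Finset.sum_congr rfl fun i _ => ?_
  rw [← Finset.smul_sum, sum_apply_spectralProj_of_eigenvector hA hs (hu i)]

theorem tripleFun_apply {ι κ : Type*} [Fintype ι] [Fintype κ] (hA : IsFiniteRankSelfAdjoint A)
    (hB : IsFiniteRankSelfAdjoint B) (hC : IsFiniteRankSelfAdjoint C)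
    (f : EuclideanSpace ℝ (Fin 3) → ℂ) {u : ι → H} {a : ι → ℝ} {v : κ → H} {b : κ → ℝ}
    {w : H} {c : ℝ} (hu : ∀ i, A (u i) = (a i : ℂ) • u i) (hv : ∀ k, B (v k) = (b k : ℂ) • v k)
    (hw : C w = (c : ℂ) • w) {α : κ → ι → ℂ} {β : κ → ℂ}
    (hvu : ∀ k, v k = ∑ i, α k i • u i) (hwv : w = ∑ k, β k • v k) :
    tripleFun f A B C w = ∑ i, (∑ k, f !₂[a i, b k, c] * (β k * α k i)) • u i := by
  obtain ⟨s, hs⟩ := (finite_support_spectralProj hA.finiteRank).exists_finset_coe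
  obtain ⟨t, ht⟩ := (finite_support_spectralProj hB.finiteRank).exists_finset_coe
  obtain ⟨r, hr⟩ := (finite_support_spectralProj hC.finiteRank).exists_finset_coe
  let F (z y : ℝ) : H →L[ℂ] H := ∑ x ∈ s, f !₂[x, y, z] • spectralProj A x
  calc tripleFun f A B C w
      = ∑ z ∈ r, (∑ y ∈ t, F z y ∘L spectralProj B y) (spectralProj C z w) := by
        rw [tripleFun_eq_sum hs.ge ht.ge hr.ge, Finset.sum_congr rfl fun x _ => Finset.sum_comm,
          Finset.sum_comm, sum_apply]
        refine Finset.sum_congr rfl fun z _ => ?_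
        rw [Finset.sum_comm]
        simp [F]
    _ = ∑ y ∈ t, F c y (spectralProj B y w) := by
        refine (sum_apply_spectralProj_of_eigenvector hC.isSelfAdjoint hr.ge hw
          fun z => ∑ y ∈ t, F z y ∘L spectralProj B y).trans ?_
        simp
    _ = ∑ k, β k • F c (b k) (v k) := by
        conv_lhs => rw [hwv]
        exact sum_apply_spectralProj_sum hB.isSelfAdjoint ht.ge hv β fun y => F c y
    _ = ∑ k, β k • ∑ i, α k i • f !₂[a i, b k, c] • u i := by
        refine Finset.sum_congr rfl fun k _ => congrArg (β k • ·) ?_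
        conv_lhs => rw [hvu k]
        simpa only [F, sum_apply, smul_apply, one_apply_eq_self] using
          sum_apply_spectralProj_sum hA.isSelfAdjoint hs.ge hu (α k)
            fun x => f !₂[x, b k, c] • (1 : H →L[ℂ] H)
    _ = ∑ i, (∑ k, f !₂[a i, b k, c] * (β k * α k i)) • u i := by
        simp only [Finset.smul_sum, Finset.sum_smul, smul_smul]
        rw [Finset.sum_comm]
        refine Finset.sum_congr rfl fun i _ => Finset.sum_congr rfl fun k _ => ?_
        congr 1
        ring

end SpectralProj

section DiagOp

open InnerProductSpace

variable {H ι : Type*} [NormedAddCommGroup H] [InnerProductSpace ℂ H] [Fintype ι]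
variable {v : ι → H}

theorem norm_sum_smul_sq (hv : Orthonormal ℂ v) (c : ι → ℂ) :
    ‖∑ i, c i • v i‖ ^ 2 = ∑ i, ‖c i‖ ^ 2 :=
  hv.orthogonalFamily.norm_sum c Finset.univ

/-- The diagonal operator `∑ i, a i ⟪v i, ·⟫ v i`, with eigenvalues `a i` when `v` is
orthonormal. -/
def diagOp (v : ι → H) (a : ι → ℝ) : H →L[ℂ] H :=
  ∑ i, (a i : ℂ) • rankOne ℂ (v i) (v i)

theorem diagOp_apply (v : ι → H) (a : ι → ℝ) (x : H) :
    diagOp v a x = ∑ i, ((a i : ℂ) * inner ℂ (v i) x) • v i := by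
  simp only [diagOp, sum_apply, smul_apply, rankOne_apply, smul_smul]

theorem diagOp_apply_self (hv : Orthonormal ℂ v) (a : ι → ℝ) (i : ι) :
    diagOp v a (v i) = (a i : ℂ) • v i := by
  classical
  simp [diagOp_apply, orthonormal_iff_ite.1 hv]

theorem diagOp_sub (v : ι → H) (a b : ι → ℝ) : diagOp v a - diagOp v b = diagOp v (a - b) := by
  simp [diagOp, ← Finset.sum_sub_distrib, sub_smul]

theorem range_diagOp_le (v : ι → H) (a : ι → ℝ) :
    LinearMap.range (diagOp v a : H →ₗ[ℂ] H) ≤ Submodule.span ℂ (Set.range v) := by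
  rintro _ ⟨x, rfl⟩
  rw [ContinuousLinearMap.coe_coe, diagOp_apply]
  exact Submodule.sum_mem _ fun i _ =>
    Submodule.smul_mem _ _ (Submodule.subset_span (Set.mem_range_self i))

theorem rank_diagOp_le (v : ι → H) (a : ι → ℝ) :
    LinearMap.rank (diagOp v a : H →ₗ[ℂ] H) ≤ (Fintype.card ι : Cardinal) := by
  have : Module.Finite ℂ (Submodule.span ℂ (Set.range v)) :=
    FiniteDimensional.span_of_finite ℂ (Set.finite_range v)
  refine (Submodule.rank_mono (range_diagOp_le v a)).trans ?_
  rw [← Module.finrank_eq_rank]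
  exact_mod_cast finrank_range_le_card v

theorem norm_diagOp_le (hv : Orthonormal ℂ v) {a : ι → ℝ} {r : ℝ} (hr : 0 ≤ r)
    (ha : ∀ i, |a i| ≤ r) : ‖diagOp v a‖ ≤ r := by
  refine ContinuousLinearMap.opNorm_le_bound _ hr fun x => ?_
  refine (sq_le_sq₀ (by positivity) (by positivity)).1 ?_
  calc ‖diagOp v a x‖ ^ 2 = ∑ i, |a i| ^ 2 * ‖inner ℂ (v i) x‖ ^ 2 := by
        rw [diagOp_apply, norm_sum_smul_sq hv]
        simp [mul_pow]
    _ ≤ ∑ i, r ^ 2 * ‖inner ℂ (v i) x‖ ^ 2 := by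
        gcongr with i
        exact ha i
    _ ≤ r ^ 2 * ‖x‖ ^ 2 := by
        rw [← Finset.mul_sum]
        gcongr
        exact hv.sum_inner_products_le x
    _ = (r * ‖x‖) ^ 2 := (mul_pow _ _ _).symm

theorem isFiniteRankSelfAdjoint_diagOp [CompleteSpace H] (v : ι → H) (a : ι → ℝ) :
    IsFiniteRankSelfAdjoint (diagOp v a) where
  isSelfAdjoint := isSelfAdjoint_sum _ fun i _ =>
    (isSelfAdjoint_iff.2 (Complex.conj_ofReal (a i))).smul
      (isPositive_rankOne_self (v i)).isSelfAdjoint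
  finiteRank := by
    have : Module.Finite ℂ (Submodule.span ℂ (Set.range v)) :=
      FiniteDimensional.span_of_finite ℂ (Set.finite_range v)
    exact Submodule.finiteDimensional_of_le (range_diagOp_le v a)

theorem schattenNorm_diagOp_le {p : ℝ≥0∞} (hp : p ≠ 0) (hv : Orthonormal ℂ v) {a : ι → ℝ} {r : ℝ}
    (hr : 0 ≤ r) (ha : ∀ i, |a i| ≤ r) :
    schattenNorm p (diagOp v a) ≤
      ENNReal.ofReal r * (Fintype.card ι : ℝ≥0∞) ^ p.toReal⁻¹ := by
  refine (schattenNorm_le_of_rank_le hp (rank_diagOp_le v a)).trans ?_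
  gcongr
  rw [← ofReal_norm]
  exact ENNReal.ofReal_le_ofReal (norm_diagOp_le hv hr ha)

theorem le_schattenNorm_of_orthonormal [Nonempty ι] {p : ℝ≥0∞} (hp : p ≠ 0) {u : ι → H}
    (hv : Orthonormal ℂ v) (hu : Orthonormal ℂ u) {T : H →L[ℂ] H} {c : ℂ}
    (hT : ∀ i, T (v i) = c • u i) :
    ‖c‖ₑ * (Fintype.card ι : ℝ≥0∞) ^ p.toReal⁻¹ ≤ schattenNorm p T := by
  have hV := finrank_span_eq_card hv.linearIndependent
  rw [← hV]
  refine le_schattenNorm hp (by rw [hV]; exact Fintype.card_ne_zero) fun x hx => ?_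
  obtain ⟨b, rfl⟩ := (Submodule.mem_span_range_iff_exists_fun ℂ).1 hx
  have hnorm : ‖∑ i, b i • u i‖ = ‖∑ i, b i • v i‖ := by
    rw [← sq_eq_sq₀ (norm_nonneg _) (norm_nonneg _), norm_sum_smul_sq hu, norm_sum_smul_sq hv]
  have hTx : T (∑ i, b i • v i) = c • ∑ i, b i • u i := by
    simp only [map_sum, map_smul, hT, smul_comm _ c, Finset.smul_sum]
  rw [hTx, enorm_smul, ← ofReal_norm (∑ i, b i • u i), hnorm, ofReal_norm]

end DiagOp

/-! ### Besov norms of trigonometric polynomials -/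

section LittlewoodPaley

variable {d : ℕ}

theorem DyadicBump.eq_zero_of_lt (w : DyadicBump) {s : ℝ} (hs : s < 1 / 2) : w.w s = 0 :=
  image_eq_zero_of_notMem_tsupport fun h => absurd (w.supp h).1 (not_le.2 hs)

theorem DyadicBump.eq_zero_of_ge (w : DyadicBump) {s : ℝ} (hs : 2 ≤ s) : w.w s = 0 := by
  have h : Set.EqOn w.w (fun _ => 0) (Set.Ioi 2) := fun x hx =>
    image_eq_zero_of_notMem_tsupport fun h => absurd (w.supp h).2 (not_le.2 hx)
  have h2 := h.closure w.smooth.continuous continuous_const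
  rw [closure_Ioi] at h2
  exact h2 hs

theorem DyadicBump.hasSum_div_zpow (w : DyadicBump) {t : ℝ} (ht : 0 < t) :
    HasSum (fun n : ℤ => w.w (t / 2 ^ n)) 1 := by
  obtain ⟨m, hm1, hm2⟩ := exists_mem_Ico_zpow ht (one_lt_two (α := ℝ))
  have hpos (n : ℤ) : (0 : ℝ) < 2 ^ n := by positivity
  have hsum : ∑ n ∈ ({m, m + 1} : Finset ℤ), w.w (t / 2 ^ n) = 1 := by
    rw [Finset.sum_pair (by simp)]
    have h1 : (1 : ℝ) ≤ t / 2 ^ m := (one_le_div (hpos m)).2 hm1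
    have h2 : t / 2 ^ m ≤ 2 := by
      rw [div_le_iff₀ (hpos m)]
      rw [zpow_add_one₀ two_ne_zero] at hm2
      linarith
    rw [w.partition _ ⟨h1, h2⟩, zpow_add_one₀ two_ne_zero, div_div]
    ring
  rw [← hsum]
  refine hasSum_sum_of_ne_finset_zero fun n hn => ?_
  simp only [Finset.mem_insert, Finset.mem_singleton, not_or] at hn
  rcases lt_or_ge n m with h | h
  · refine w.eq_zero_of_ge ((le_div_iff₀ (hpos n)).2 (le_trans ?_ hm1))
    rw [mul_comm, ← zpow_add_one₀ two_ne_zero]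
    exact zpow_le_zpow_right₀ one_le_two (by omega)
  · refine w.eq_zero_of_lt ((div_lt_iff₀ (hpos n)).2 (hm2.trans_le ?_))
    have hle : (2 : ℝ) ^ (m + 1) ≤ 2 ^ (n - 1) := zpow_le_zpow_right₀ one_le_two (by omega)
    rw [zpow_sub_one₀ two_ne_zero] at hle
    linarith

theorem fourier_lpKernel (w : DyadicBump) (n : ℤ) (ξ : EuclideanSpace ℝ (Fin d)) :
    𝓕 (lpKernel (d := d) w n) ξ = lpSymbolFun w n ξ := by
  simp [lpKernel]

theorem lpSymbolFun_eq_zero_apply_smul (w : DyadicBump) (n : ℤ) (ξ : EuclideanSpace ℝ (Fin d)) :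
    lpSymbolFun w n ξ = lpSymbolFun w 0 (((2 : ℝ) ^ n)⁻¹ • ξ) := by
  have h : (0 : ℝ) < 2 ^ n := by positivity
  unfold lpSymbolFun
  rw [smul_comm _ ((2 : ℝ) ^ n)⁻¹, norm_smul ((2 : ℝ) ^ n)⁻¹, norm_inv, Real.norm_of_nonneg h.le]
  simp only [zpow_zero, div_one]
  rw [inv_mul_eq_div]

theorem lpKernel_eq_integral (w : DyadicBump) (n : ℤ) (x : EuclideanSpace ℝ (Fin d)) :
    lpKernel w n x = ∫ ξ, Real.fourierChar (inner ℝ ξ x) • lpSymbolFun w n ξ := by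
  rw [lpKernel, SchwartzMap.fourierInv_coe, Real.fourierInv_eq]
  rfl

theorem lpKernel_eq_smul_zero_apply (w : DyadicBump) (n : ℤ) (x : EuclideanSpace ℝ (Fin d)) :
    lpKernel w n x = ((2 : ℝ) ^ n) ^ d • lpKernel w 0 ((2 : ℝ) ^ n • x) := by
  have h : (0 : ℝ) < 2 ^ n := by positivity
  have hscale := Measure.integral_comp_smul volume
    (fun ξ : EuclideanSpace ℝ (Fin d) =>
      Real.fourierChar (inner ℝ ξ ((2 : ℝ) ^ n • x)) • lpSymbolFun w 0 ξ) ((2 : ℝ) ^ n)⁻¹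
  simp only [← lpSymbolFun_eq_zero_apply_smul, real_inner_smul_left, real_inner_smul_right,
    mul_inv_cancel_left₀ h.ne', finrank_euclideanSpace, Fintype.card_fin] at hscale
  rw [abs_of_nonneg (by positivity), inv_pow, inv_inv] at hscale
  simp only [lpKernel_eq_integral, hscale, real_inner_smul_right]

theorem integral_norm_lpKernel (w : DyadicBump) (n : ℤ) :
    ∫ x : EuclideanSpace ℝ (Fin d), ‖lpKernel w n x‖ =
      ∫ x : EuclideanSpace ℝ (Fin d), ‖lpKernel w 0 x‖ := by
  have hscale := Measure.integral_comp_smul volume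
    (fun x : EuclideanSpace ℝ (Fin d) => ‖lpKernel w 0 x‖) ((2 : ℝ) ^ n)
  simp_rw [lpKernel_eq_smul_zero_apply w n, norm_smul, integral_const_mul]
  rw [hscale, finrank_euclideanSpace, Fintype.card_fin, smul_eq_mul, norm_pow, norm_zpow,
    Real.norm_of_nonneg zero_le_two, abs_of_nonneg (by positivity)]
  field_simp

end LittlewoodPaley

section TrigPoly

variable {d : ℕ} {ι : Type*} [Fintype ι]

local notation "E" => EuclideanSpace ℝ (Fin d)

/-- The character `x ↦ e^{2πi⟪x, κ⟫}` of frequency `κ`. -/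
def planeWave (κ x : E) : ℂ := Real.fourierChar (inner ℝ x κ)

/-- The trigonometric polynomial with frequencies `κ i` and coefficients `c i`. -/
def trigPoly (κ : ι → E) (c : ι → ℂ) : E → ℂ := ∑ i, c i • planeWave (κ i)

/-- The trigonometric polynomial `trigPoly κ c` as a tempered distribution, namely the inverse
Fourier transform of `∑ i, c i • δ_{κ i}`. -/
def trigDist (κ : ι → E) (c : ι → ℂ) : 𝓢'(E, ℂ) :=
  ∑ i, c i • 𝓕⁻ (TemperedDistribution.delta (κ i))

theorem continuous_planeWave (κ : E) : Continuous (planeWave κ) := by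
  unfold planeWave
  fun_prop

theorem norm_planeWave (κ x : E) : ‖planeWave κ x‖ = 1 := Circle.norm_coe _

theorem planeWave_add (κ κ' : E) : planeWave (κ + κ') = planeWave κ * planeWave κ' := by
  ext x
  simp [planeWave, inner_add_right, AddChar.map_add_eq_mul]

theorem trigPoly_apply (κ : ι → E) (c : ι → ℂ) (x : E) :
    trigPoly κ c x = ∑ i, c i * planeWave (κ i) x := by
  simp [trigPoly]

theorem trigDist_apply (κ : ι → E) (c : ι → ℂ) (u : 𝓢(E, ℂ)) :
    trigDist κ c u = ∑ i, c i * 𝓕⁻ u (κ i) := by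
  simp [trigDist]

theorem continuous_trigPoly (κ : ι → E) (c : ι → ℂ) : Continuous (trigPoly κ c) := by
  rw [funext (trigPoly_apply κ c)]
  exact continuous_finsetSum _ fun i _ => (continuous_planeWave (κ i)).const_mul (c i)

theorem norm_trigPoly_le (κ : ι → E) (c : ι → ℂ) (x : E) : ‖trigPoly κ c x‖ ≤ ∑ i, ‖c i‖ := by
  rw [trigPoly_apply]
  exact (norm_sum_le _ _).trans_eq (by simp [norm_planeWave])

theorem integrable_mul_planeWave (κ : E) (u : 𝓢(E, ℂ)) :
    Integrable fun x => u x * planeWave κ x :=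
  u.integrable.mul_bdd (c := 1) (continuous_planeWave κ).aestronglyMeasurable
    (.of_forall fun x => (norm_planeWave κ x).le)

theorem fourierInv_eq_integral_mul_planeWave (κ : E) (u : 𝓢(E, ℂ)) :
    𝓕⁻ u κ = ∫ x, u x * planeWave κ x := by
  rw [SchwartzMap.fourierInv_coe, Real.fourierInv_eq]
  simp only [Circle.smul_def, smul_eq_mul, planeWave, mul_comm]

theorem mul_trigPoly_apply (κ : ι → E) (c : ι → ℂ) (u : 𝓢(E, ℂ)) (x : E) :
    u x * trigPoly κ c x = ∑ i, c i * (u x * planeWave (κ i) x) := by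
  simp only [trigPoly_apply, Finset.mul_sum, mul_left_comm (u x)]

theorem isContinuousRepr_trigPoly (κ : ι → E) (c : ι → ℂ) :
    IsContinuousRepr (trigPoly κ c) (trigDist κ c) where
  continuous := continuous_trigPoly κ c
  integrable u := by
    simp only [mul_trigPoly_apply]
    exact integrable_finsetSum _ fun i _ => (integrable_mul_planeWave (κ i) u).const_mul (c i)
  apply_eq u := by
    simp only [trigDist_apply, mul_trigPoly_apply]
    rw [integral_finsetSum _ fun i _ => (integrable_mul_planeWave (κ i) u).const_mul (c i)]
    simp only [integral_const_mul, fourierInv_eq_integral_mul_planeWave]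

theorem IsContinuousRepr.linftyNorm_le {f : E → ℂ} {T : 𝓢'(E, ℂ)} (hf : IsContinuousRepr f T)
    {b : ℝ} (hb : ∀ x, ‖f x‖ ≤ b) : linftyNorm T ≤ ENNReal.ofReal b := by
  have hmem : MemLp f ⊤ (volume : Measure E) :=
    memLp_top_of_bound hf.continuous.aestronglyMeasurable b (.of_forall hb)
  refine (iInf₂_le (hmem.toLp _) ?_).trans ?_
  · ext u
    rw [Lp.toTemperedDistribution_apply, hf.apply_eq]
    refine integral_congr_ae ?_
    filter_upwards [hmem.coeFn_toLp] with x hx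
    rw [hx, smul_eq_mul]
  · rw [Lp.enorm_toLp]
    exact eLpNorm_exponent_top.trans_le (eLpNormEssSup_le_of_ae_bound (.of_forall hb))

theorem distConv_trigDist (κ : ι → E) (c : ι → ℂ) (W : 𝓢(E, ℂ)) :
    distConv (trigDist κ c) W = trigDist κ fun i => c i * 𝓕 W (κ i) := by
  ext u
  change trigDist κ c (SchwartzMap.convolution _ _ u) = _
  rw [trigDist_apply, trigDist_apply]
  refine Finset.sum_congr rfl fun i _ => ?_
  have hinv (g : 𝓢(E, ℂ)) : 𝓕⁻ g (κ i) = 𝓕 g (-κ i) := by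
    rw [SchwartzMap.fourierInv_coe, SchwartzMap.fourier_coe, Real.fourierInv_eq_fourier_neg]
  have hneg : 𝓕 (SchwartzMap.compCLMOfContinuousLinearEquiv ℂ
      (ContinuousLinearEquiv.neg ℝ : E ≃L[ℝ] E) W) (-κ i) = 𝓕 W (κ i) := by
    rw [SchwartzMap.fourier_coe, SchwartzMap.fourier_coe,
      SchwartzMap.compCLMOfContinuousLinearEquiv_apply]
    have h := congrFun (Real.fourierInv_eq_fourier_comp_neg (W : E → ℂ)) (-κ i)
    rw [Real.fourierInv_eq_fourier_neg, neg_neg] at h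
    exact h.symm
  rw [hinv, hinv, SchwartzMap.fourier_convolution, SchwartzMap.pairing_apply_apply, hneg,
    ContinuousLinearMap.mul_apply', mul_assoc]

theorem planeWave_mul_fourier (κ : E) (W : 𝓢(E, ℂ)) (x : E) :
    planeWave κ x * 𝓕 W κ = ∫ y, W y * planeWave κ (x - y) := by
  rw [SchwartzMap.fourier_coe, Real.fourier_eq, ← integral_const_mul]
  refine integral_congr_ae (.of_forall fun y => ?_)
  simp only [planeWave, Circle.smul_def, smul_eq_mul, sub_eq_add_neg, inner_add_left,
    inner_neg_left, AddChar.map_add_eq_mul, Circle.coe_mul]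
  ring

theorem trigPoly_mul_fourier (κ : ι → E) (c : ι → ℂ) (W : 𝓢(E, ℂ)) (x : E) :
    trigPoly κ (fun i => c i * 𝓕 W (κ i)) x = ∫ y, W y * trigPoly κ c (x - y) := by
  have h_int (i : ι) : Integrable fun y => c i * (W y * planeWave (κ i) (x - y)) :=
    (W.integrable.mul_bdd (c := 1)
      ((continuous_planeWave (κ i)).comp (continuous_sub_left x)).aestronglyMeasurable
      (.of_forall fun y => (norm_planeWave (κ i) (x - y)).le)).const_mul (c i)
  simp only [trigPoly_apply, Finset.mul_sum, mul_left_comm (W _)]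
  rw [integral_finsetSum _ fun i _ => h_int i]
  refine Finset.sum_congr rfl fun i _ => ?_
  rw [integral_const_mul, ← planeWave_mul_fourier]
  ring

theorem norm_trigPoly_mul_fourier_le (κ : ι → E) (c : ι → ℂ) (W : 𝓢(E, ℂ)) {b : ℝ}
    (hb : ∀ x, ‖trigPoly κ c x‖ ≤ b) (x : E) :
    ‖trigPoly κ (fun i => c i * 𝓕 W (κ i)) x‖ ≤ (∫ y, ‖W y‖) * b := by
  rw [trigPoly_mul_fourier, ← integral_mul_const]
  refine norm_integral_le_of_norm_le (W.integrable.norm.mul_const b) (.of_forall fun y => ?_)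
  rw [norm_mul]
  gcongr
  exact hb _

end TrigPoly

section Besov

variable {d : ℕ} {ι : Type*} [Fintype ι]

local notation "E" => EuclideanSpace ℝ (Fin d)

theorem fourierInv_lineDeriv_zero (v : E) (u : 𝓢(E, ℂ)) : 𝓕⁻ (∂_{v} u) (0 : E) = 0 := by
  have h : (fun x : E => inner ℝ x v).HasTemperateGrowth := by fun_prop
  rw [SchwartzMap.fourierInv_lineDerivOp_eq, smul_apply,
    SchwartzMap.smulLeftCLM_apply_apply h]
  simp

theorem hasSum_lpSymbolFun (w : DyadicBump) {κ : E} (hκ : κ ≠ 0) :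
    HasSum (fun n : ℤ => lpSymbolFun w n κ) 1 := by
  have h : 0 < ‖(2 * Real.pi) • κ‖ := norm_pos_iff.2 (smul_ne_zero (by positivity) hκ)
  exact_mod_cast (w.hasSum_div_zpow h).mapL Complex.ofRealCLM

theorem hasSum_lineDeriv_trigDist (w : DyadicBump) (κ : ι → E) (c : ι → ℂ) (v : E) :
    HasSum (fun n : ℤ => ∂_{v} (distConv (trigDist κ c) (lpKernel w n)))
      (∂_{v} (trigDist κ c)) := by
  refine PointwiseConvergenceCLM.tendsto_iff_forall_tendsto.2 fun u => ?_
  have hu : HasSum (fun n : ℤ => ∂_{v} (distConv (trigDist κ c) (lpKernel w n)) u)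
      (∂_{v} (trigDist κ c) u) := by
    simp only [distConv_trigDist, fourier_lpKernel, TemperedDistribution.lineDerivOp_apply_apply,
      map_neg, trigDist_apply]
    refine HasSum.neg (hasSum_sum fun i _ => ?_)
    rcases eq_or_ne (κ i) 0 with h | h
    · simp only [h, fourierInv_lineDeriv_zero, mul_zero]
      exact hasSum_zero
    · simpa using ((hasSum_lpSymbolFun w h).mul_left (c i)).mul_right (𝓕⁻ (∂_{v} u) (κ i))
  simpa [HasSum] using hu

theorem tsum_ite_le_two_zpow (N : ℤ) :
    ∑' n : ℤ, (if n ≤ N then (2 : ℝ≥0∞) ^ n else 0) = 2 ^ (N + 1) := by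
  have hinj : Function.Injective fun k : ℕ => N - (k : ℤ) := fun a b h => by simpa using h
  rw [← hinj.tsum_eq]
  · have h (k : ℕ) : (2 : ℝ≥0∞) ^ (N - (k : ℤ)) = 2 ^ N * 2⁻¹ ^ k := by
      rw [ENNReal.zpow_sub two_ne_zero ENNReal.ofNat_ne_top, zpow_natCast, ENNReal.inv_pow]
    simp only [sub_le_self_iff, Nat.cast_nonneg, if_true, h]
    rw [ENNReal.tsum_mul_left, ENNReal.tsum_geometric, ENNReal.one_sub_inv_two, inv_inv,
      ENNReal.zpow_add two_ne_zero ENNReal.ofNat_ne_top, zpow_one]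
  · intro n hn
    have hnN : n ≤ N := of_not_not fun h => hn (if_neg h)
    exact ⟨(N - n).toNat, by simp [hnN]⟩

theorem linftyNorm_distConv_lpKernel_le (w : DyadicBump) (n : ℤ) {κ : ι → E} {c : ι → ℂ} {b : ℝ}
    (hb : ∀ x, ‖trigPoly κ c x‖ ≤ b) :
    linftyNorm (distConv (trigDist κ c) (lpKernel w n)) ≤
      ENNReal.ofReal ((∫ x : E, ‖lpKernel w 0 x‖) * b) := by
  rw [distConv_trigDist, ← integral_norm_lpKernel w n]
  exact (isContinuousRepr_trigPoly κ _).linftyNorm_le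
    (norm_trigPoly_mul_fourier_le κ c (lpKernel w n) hb)

theorem linftyNorm_distConv_lpKernel_eq_zero (w : DyadicBump) {n : ℤ} {κ : ι → E} (c : ι → ℂ)
    (hκ : ∀ i, ‖(2 * Real.pi) • κ i‖ < 2 ^ n / 2) :
    linftyNorm (distConv (trigDist κ c) (lpKernel w n)) = 0 := by
  have hzero (i : ι) : c i * 𝓕 (lpKernel w n) (κ i) = 0 := by
    rw [fourier_lpKernel, lpSymbolFun, w.eq_zero_of_lt, Complex.ofReal_zero, mul_zero]
    rw [div_lt_iff₀ (by positivity)]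
    linarith [hκ i]
  rw [distConv_trigDist, ← nonpos_iff_eq_zero, ← ENNReal.ofReal_zero]
  exact (isContinuousRepr_trigPoly κ _).linftyNorm_le fun x => by simp [trigPoly_apply, hzero]

theorem besovNorm_trigDist_le (w : DyadicBump) {N : ℤ} {κ : ι → E} {c : ι → ℂ} {b : ℝ}
    (hκ : ∀ i, ‖(2 * Real.pi) • κ i‖ ≤ 2 ^ N / 2) (hb : ∀ x, ‖trigPoly κ c x‖ ≤ b) :
    besovNorm w (trigDist κ c) ≤
      2 ^ (N + 1) * ENNReal.ofReal ((∫ x : E, ‖lpKernel w 0 x‖) * b) := by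
  rw [← tsum_ite_le_two_zpow, ← ENNReal.tsum_mul_right]
  refine ENNReal.tsum_le_tsum fun n => ?_
  split_ifs with hn
  · gcongr
    exact linftyNorm_distConv_lpKernel_le w n hb
  · have hNn : (2 : ℝ) ^ N < 2 ^ n := zpow_lt_zpow_right₀ one_lt_two (not_le.1 hn)
    rw [linftyNorm_distConv_lpKernel_eq_zero w c fun i => (hκ i).trans_lt (by linarith)]
    simp

theorem memBesov_trigDist (w : DyadicBump) (κ : ι → E) (c : ι → ℂ) :
    MemBesov w (trigDist κ c) where
  norm_ne_top := by
    obtain ⟨r, hr⟩ := (Set.finite_range fun i => ‖(2 * Real.pi) • κ i‖).bddAbove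
    obtain ⟨N, hN⟩ := pow_unbounded_of_one_lt (r * 2) one_lt_two
    have hκ (i : ι) : ‖(2 * Real.pi) • κ i‖ ≤ 2 ^ (N : ℤ) / 2 := by
      rw [le_div_iff₀ two_pos, zpow_natCast]
      exact (mul_le_mul_of_nonneg_right (hr ⟨i, rfl⟩) zero_le_two).trans hN.le
    exact ne_top_of_le_ne_top
      (ENNReal.mul_ne_top (ENNReal.zpow_ne_top two_ne_zero ENNReal.ofNat_ne_top _)
        ENNReal.ofReal_ne_top)
      (besovNorm_trigDist_le w hκ (norm_trigPoly_le κ c))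
  hasSum_deriv _ := hasSum_lineDeriv_trigDist w κ c _

end Besov

section TrigPolySpace

variable {d : ℕ}

local notation "E" => EuclideanSpace ℝ (Fin d)

/-- The trigonometric polynomials with frequencies in the closed ball of radius `r`. -/
def trigPolySpace (r : ℝ) : Submodule ℂ (E → ℂ) :=
  Submodule.span ℂ (planeWave '' Metric.closedBall 0 r)

theorem mul_mem_trigPolySpace {r s : ℝ} {f g : E → ℂ} (hf : f ∈ trigPolySpace r)
    (hg : g ∈ trigPolySpace s) : f * g ∈ trigPolySpace (r + s) := by
  have h := Submodule.mul_mem_mul hf hg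
  rw [trigPolySpace, trigPolySpace, Submodule.span_mul_span] at h
  refine Submodule.span_mono ?_ h
  rintro _ ⟨_, ⟨κ, hκ, rfl⟩, _, ⟨κ', hκ', rfl⟩, rfl⟩
  rw [mem_closedBall_zero_iff] at hκ hκ'
  exact ⟨κ + κ', mem_closedBall_zero_iff.2 (norm_add_le_of_le hκ hκ'), planeWave_add κ κ'⟩

theorem fourierChar_mul_coord_mem_trigPolySpace {s r : ℝ} (hs : |s| ≤ r) (i : Fin d) :
    (fun x : E => (Real.fourierChar (s * x i) : ℂ)) ∈ trigPolySpace r := by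
  refine Submodule.subset_span ⟨EuclideanSpace.single i s, ?_, ?_⟩
  · simpa using hs
  · ext x
    simp [planeWave, EuclideanSpace.inner_single_right]

theorem exists_memBesov_of_mem_trigPolySpace (w : DyadicBump) {N : ℤ} {r b : ℝ}
    (hr : 2 * Real.pi * r ≤ 2 ^ N / 2) {f : E → ℂ} (hf : f ∈ trigPolySpace r)
    (hb : ∀ x, ‖f x‖ ≤ b) :
    ∃ T : 𝓢'(E, ℂ), IsContinuousRepr f T ∧ MemBesov w T ∧
      besovNorm w T ≤ 2 ^ (N + 1) * ENNReal.ofReal ((∫ x : E, ‖lpKernel w 0 x‖) * b) := by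
  obtain ⟨n, c, g, hcg⟩ := Submodule.mem_span_set'.1 hf
  choose κ hκ hg using fun i => (g i).2
  obtain rfl : trigPoly κ c = f := by simp only [trigPoly, hg, hcg]
  refine ⟨trigDist κ c, isContinuousRepr_trigPoly κ c, memBesov_trigDist w κ c,
    besovNorm_trigDist_le w (fun i => ?_) hb⟩
  rw [norm_smul, Real.norm_of_nonneg Real.two_pi_pos.le]
  exact (mul_le_mul_of_nonneg_left (mem_closedBall_zero_iff.1 (hκ i)) Real.two_pi_pos.le).trans hr

end TrigPolySpace

/-! ### The discrete Fourier transform and Fejér kernels -/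

section DFT

variable {M : ℕ} [NeZero M] {H : Type*} [NormedAddCommGroup H] [InnerProductSpace ℂ H]

theorem sum_stdAddChar_mul (b : ZMod M) :
    ∑ x : ZMod M, ZMod.stdAddChar (x * b) = if b = 0 then (M : ℂ) else 0 := by
  rw [AddChar.sum_mulShift b (ZMod.isPrimitive_stdAddChar M), ZMod.card]
  split_ifs <;> simp

theorem inner_dft_dft {e : ZMod M → H} (he : Orthonormal ℂ e) (j k : ZMod M) :
    inner ℂ (ZMod.dft e j) (ZMod.dft e k) = if j = k then (M : ℂ) else 0 := by
  have h (m : ZMod M) : starRingEnd ℂ (ZMod.stdAddChar (-(m * j))) * ZMod.stdAddChar (-(m * k)) =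
      ZMod.stdAddChar (m * (j - k)) := by
    rw [← AddChar.map_neg_eq_conj, ← AddChar.map_add_eq_mul]
    ring_nf
  simp only [ZMod.dft_apply, he.inner_sum, h, sum_stdAddChar_mul, sub_eq_zero]

theorem ofReal_sqrt_natCast_mul_self (n : ℕ) : (√(n : ℝ) : ℂ) * √(n : ℝ) = n := by
  exact_mod_cast Real.mul_self_sqrt n.cast_nonneg

theorem orthonormal_inv_sqrt_smul_dft {e : ZMod M → H} (he : Orthonormal ℂ e) :
    Orthonormal ℂ ((√(M : ℝ) : ℂ)⁻¹ • ZMod.dft e) := by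
  rw [orthonormal_iff_ite]
  intro j k
  rw [Pi.smul_apply, Pi.smul_apply, inner_smul_left, inner_smul_right, inner_dft_dft he, map_inv₀,
    Complex.conj_ofReal, ← mul_assoc, ← mul_inv, ofReal_sqrt_natCast_mul_self]
  split_ifs <;> simp

theorem sum_smul_dft (c : ZMod M → ℂ) (e : ZMod M → H) :
    ∑ j, c j • ZMod.dft e j = ∑ m, ZMod.dft c m • e m := by
  simp only [ZMod.dft_apply, Finset.smul_sum, Finset.sum_smul, smul_eq_mul, smul_smul]
  rw [Finset.sum_comm]
  simp only [mul_comm]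

theorem sum_norm_dft_sq (c : ZMod M → ℂ) :
    ∑ m, ‖ZMod.dft c m‖ ^ 2 = M * ∑ j, ‖c j‖ ^ 2 := by
  have he := (EuclideanSpace.basisFun (ZMod M) ℂ).orthonormal
  have hM : (√(M : ℝ) : ℂ) ≠ 0 := by simp [NeZero.ne]
  calc ∑ m, ‖ZMod.dft c m‖ ^ 2
      = ‖∑ j, (c j * √(M : ℝ)) • ((√(M : ℝ) : ℂ)⁻¹ •
          ZMod.dft (EuclideanSpace.basisFun (ZMod M) ℂ)) j‖ ^ 2 := by
        rw [← norm_sum_smul_sq he, ← sum_smul_dft]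
        simp only [Pi.smul_apply, smul_smul, mul_inv_cancel_right₀ hM]
    _ = M * ∑ j, ‖c j‖ ^ 2 := by
        rw [norm_sum_smul_sq (orthonormal_inv_sqrt_smul_dft he)]
        simp [mul_pow, Finset.mul_sum, mul_comm]

end DFT

section Fejer

/-- The Fejér kernel of period `M`, normalized by the value `1` at `0`. -/
def fejer (M : ℕ) [NeZero M] (t : ℝ) : ℝ :=
  (‖∑ l : ZMod M, (Real.fourierChar (l.val / M * t) : ℂ)‖ / M) ^ 2

variable {M : ℕ} [NeZero M]

theorem fourierChar_intCast_div (n : ℤ) :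
    (Real.fourierChar ((n : ℝ) / M) : ℂ) = ZMod.stdAddChar (n : ZMod M) := by
  rw [ZMod.stdAddChar_coe, Real.fourierChar_apply]
  congr 1
  push_cast
  ring

theorem fourierChar_val_div_mul (l : ZMod M) (n : ℤ) :
    (Real.fourierChar (l.val / M * n) : ℂ) = ZMod.stdAddChar (l * (n : ZMod M)) := by
  have h := fourierChar_intCast_div (M := M) (l.val * n)
  push_cast [ZMod.natCast_zmod_val] at h
  rw [← h, div_mul_eq_mul_div]

theorem fourierChar_add (s t : ℝ) :
    (Real.fourierChar (s + t) : ℂ) = Real.fourierChar s * Real.fourierChar t := by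
  rw [AddChar.map_add_eq_mul, Circle.coe_mul]

theorem fejer_nonneg (t : ℝ) : 0 ≤ fejer M t := sq_nonneg _

theorem sum_fejer_sub_val (t : ℝ) : ∑ j : ZMod M, fejer M (t - j.val) = 1 := by
  have h (j : ZMod M) : ∑ l : ZMod M, (Real.fourierChar (l.val / M * (t - j.val)) : ℂ) =
      ZMod.dft (fun l : ZMod M => (Real.fourierChar (l.val / M * t) : ℂ)) j := by
    rw [ZMod.dft_apply]
    refine Finset.sum_congr rfl fun l _ => ?_
    have hl := fourierChar_val_div_mul l (-j.val)
    push_cast [ZMod.natCast_zmod_val, mul_neg] at hl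
    rw [smul_eq_mul, ← hl, ← fourierChar_add]
    ring_nf
  have hM : (M : ℝ) ≠ 0 := NeZero.ne _
  simp only [fejer, h, div_pow, ← Finset.sum_div, sum_norm_dft_sq, Circle.norm_coe]
  simp [← sq, hM]

theorem fejer_val_sub_val (i j : ZMod M) :
    fejer M (i.val - j.val) = if i = j then 1 else 0 := by
  have h (l : ZMod M) : (Real.fourierChar (l.val / M * (i.val - j.val)) : ℂ) =
      ZMod.stdAddChar (l * (i - j)) := by
    have hl := fourierChar_val_div_mul l (i.val - j.val)
    push_cast [ZMod.natCast_zmod_val] at hl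
    exact hl
  have hM : (M : ℝ) ≠ 0 := NeZero.ne _
  simp only [fejer, h, sum_stdAddChar_mul, sub_eq_zero]
  split_ifs <;> simp [hM]

theorem val_div_mem_Icc (l : ZMod M) : (l.val / M : ℝ) ∈ Set.Icc 0 1 :=
  ⟨by positivity, div_le_one_of_le₀ (by exact_mod_cast l.val_le) M.cast_nonneg⟩

theorem fejer_sub_mem_trigPolySpace {d : ℕ} (t : ℝ) (i : Fin d) :
    (fun x : EuclideanSpace ℝ (Fin d) => (fejer M (x i - t) : ℂ)) ∈ trigPolySpace 2 := by
  have hchar (s : ℝ) (hs : |s| ≤ 1) : (fun x : EuclideanSpace ℝ (Fin d) =>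
      (Real.fourierChar (s * (x i - t)) : ℂ)) ∈ trigPolySpace 1 := by
    have h : (fun x : EuclideanSpace ℝ (Fin d) => (Real.fourierChar (s * (x i - t)) : ℂ)) =
        (Real.fourierChar (-(s * t)) : ℂ) • fun x => (Real.fourierChar (s * x i) : ℂ) := by
      ext x
      rw [Pi.smul_apply, smul_eq_mul, ← fourierChar_add]
      ring_nf
    rw [h]
    exact Submodule.smul_mem _ _ (fourierChar_mul_coord_mem_trigPolySpace hs i)
  have h : (fun x : EuclideanSpace ℝ (Fin d) => (fejer M (x i - t) : ℂ)) =
      ((M : ℂ) ^ 2)⁻¹ • ((∑ l : ZMod M, fun x => (Real.fourierChar (l.val / M * (x i - t)) : ℂ)) *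
        ∑ l : ZMod M, fun x => (Real.fourierChar (-(l.val / M) * (x i - t)) : ℂ)) := by
    ext x
    simp only [fejer, Pi.smul_apply, Pi.mul_apply, Finset.sum_apply]
    simp only [neg_mul, AddChar.map_neg_eq_inv, Circle.coe_inv_eq_conj, ← map_sum]
    rw [Complex.mul_conj', smul_eq_mul, div_pow, div_eq_inv_mul]
    push_cast
    rfl
  rw [h, ← one_add_one_eq_two]
  refine Submodule.smul_mem _ _ (mul_mem_trigPolySpace ?_ ?_) <;>
    refine Submodule.sum_mem _ fun l _ => hchar _ ?_
  · exact abs_le.2 ⟨by linarith [(val_div_mem_Icc l).1], (val_div_mem_Icc l).2⟩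
  · exact abs_le.2 ⟨by linarith [(val_div_mem_Icc l).2], by linarith [(val_div_mem_Icc l).1]⟩

end Fejer

/-! ### The counterexample -/

section Chirp

variable {M : ℕ} [NeZero M]

/-- A trigonometric polynomial of sup norm at most `1` whose frequencies are bounded independently
of `M`. Its values at the points `(j, m, k)` with integer coordinates in `[0, M)` are
`e^{2πi((k - j)m - jk)/M}`, and it vanishes where the middle coordinate is a half-integer. -/
def chirp (M : ℕ) [NeZero M] (x : EuclideanSpace ℝ (Fin 3)) : ℂ :=
  ∑ j : ZMod M, ∑ k : ZMod M, ZMod.stdAddChar (-(j * k)) *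
    (fejer M (x 0 - j.val) * fejer M (x 2 - k.val) *
      Real.fourierChar ((k.val - j.val) / M * x 1) * ((1 + Real.fourierChar (x 1)) / 2))

theorem norm_stdAddChar (j : ZMod M) : ‖(ZMod.stdAddChar j : ℂ)‖ = 1 := Circle.norm_coe _

theorem norm_one_add_circle_div_two_le (z : Circle) : ‖(1 + z : ℂ) / 2‖ ≤ 1 := by
  rw [norm_div, Complex.norm_ofNat, div_le_one two_pos]
  refine (norm_add_le _ _).trans ?_
  rw [norm_one, Circle.norm_coe, one_add_one_eq_two]

theorem norm_chirp_le (x : EuclideanSpace ℝ (Fin 3)) : ‖chirp M x‖ ≤ 1 := by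
  have hterm (j k : ZMod M) : ‖(ZMod.stdAddChar (-(j * k)) *
      (fejer M (x 0 - j.val) * fejer M (x 2 - k.val) *
        Real.fourierChar ((k.val - j.val) / M * x 1) *
          ((1 + Real.fourierChar (x 1)) / 2)) : ℂ)‖ ≤
      fejer M (x 0 - j.val) * fejer M (x 2 - k.val) := by
    simp only [norm_mul, norm_stdAddChar, Circle.norm_coe, one_mul, mul_one, Complex.norm_real,
      Real.norm_of_nonneg (fejer_nonneg _)]
    exact mul_le_of_le_one_right (mul_nonneg (fejer_nonneg _) (fejer_nonneg _))
      (norm_one_add_circle_div_two_le _)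
  calc ‖chirp M x‖
      ≤ ∑ j : ZMod M, ∑ k : ZMod M, fejer M (x 0 - j.val) * fejer M (x 2 - k.val) :=
        norm_sum_le_of_le _ fun j _ => norm_sum_le_of_le _ fun k _ => hterm j k
    _ = 1 := by rw [← Fintype.sum_mul_sum, sum_fejer_sub_val, sum_fejer_sub_val, one_mul]

theorem half_one_add_fourierChar_coord_mem_trigPolySpace {d : ℕ} (i : Fin d) :
    (fun x : EuclideanSpace ℝ (Fin d) => (1 + Real.fourierChar (x i) : ℂ) / 2) ∈
      trigPolySpace 1 := by
  have h : (fun x : EuclideanSpace ℝ (Fin d) => (1 + Real.fourierChar (x i) : ℂ) / 2) =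
      (1 / 2 : ℂ) • ((fun x => (Real.fourierChar (0 * x i) : ℂ)) +
        fun x => (Real.fourierChar (1 * x i) : ℂ)) := by
    ext x
    simp [div_eq_inv_mul]
  rw [h]
  exact Submodule.smul_mem _ _ (Submodule.add_mem _
    (fourierChar_mul_coord_mem_trigPolySpace (by simp) i)
    (fourierChar_mul_coord_mem_trigPolySpace (by simp) i))

theorem chirp_mem_trigPolySpace : chirp M ∈ trigPolySpace 6 := by
  have hfreq (j k : ZMod M) : |((k.val - j.val) / M : ℝ)| ≤ 1 := by
    rw [sub_div]
    exact (abs_sub_le_of_le_of_le (val_div_mem_Icc k).1 (val_div_mem_Icc k).2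
      (val_div_mem_Icc j).1 (val_div_mem_Icc j).2).trans_eq (sub_zero 1)
  have hchirp : chirp M = ∑ j : ZMod M, ∑ k : ZMod M, ZMod.stdAddChar (-(j * k)) •
      ((fun x => (fejer M (x 0 - j.val) : ℂ)) * (fun x => (fejer M (x 2 - k.val) : ℂ)) *
        (fun x => (Real.fourierChar ((k.val - j.val) / M * x 1) : ℂ)) *
          fun x => (1 + Real.fourierChar (x 1) : ℂ) / 2) := by
    ext x
    simp [chirp]
  rw [hchirp, show (6 : ℝ) = 2 + 2 + 1 + 1 by norm_num]
  exact Submodule.sum_mem _ fun j _ => Submodule.sum_mem _ fun k _ => Submodule.smul_mem _ _ <|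
    mul_mem_trigPolySpace (mul_mem_trigPolySpace (mul_mem_trigPolySpace
      (fejer_sub_mem_trigPolySpace _ 0) (fejer_sub_mem_trigPolySpace _ 2))
      (fourierChar_mul_coord_mem_trigPolySpace (hfreq j k) 1))
      (half_one_add_fourierChar_coord_mem_trigPolySpace 1)

theorem fourierChar_natCast (n : ℕ) : (Real.fourierChar (n : ℝ) : ℂ) = 1 := by
  rw [Real.fourierChar_apply, Complex.exp_eq_one_iff]
  exact ⟨n, by push_cast; ring⟩

theorem fourierChar_one_half : (Real.fourierChar (1 / 2) : ℂ) = -1 := by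
  rw [Real.fourierChar_apply, ← Complex.exp_pi_mul_I]
  push_cast
  ring_nf

theorem chirp_apply_val (j m k : ZMod M) :
    chirp M !₂[(j.val : ℝ), (m.val : ℝ), (k.val : ℝ)] =
      ZMod.stdAddChar (-(j * k)) * ZMod.stdAddChar ((k - j) * m) := by
  have h : (Real.fourierChar ((k.val - j.val) / M * m.val) : ℂ) =
      ZMod.stdAddChar ((k - j) * m) := by
    have hdiv := fourierChar_intCast_div (M := M) ((k.val - j.val) * m.val)
    push_cast [ZMod.natCast_zmod_val] at hdiv
    rw [← hdiv, div_mul_eq_mul_div]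
  unfold chirp
  rw [Fintype.sum_eq_single j, Fintype.sum_eq_single k]
  · simp only [Matrix.cons_val_zero, Matrix.cons_val_one, Matrix.cons_val, fejer_val_sub_val,
      fourierChar_natCast, h]
    norm_num
  · intro k' hk'
    simp only [Matrix.cons_val, fejer_val_sub_val, if_neg hk'.symm, Complex.ofReal_zero, mul_zero,
      zero_mul]
  · intro j' hj'
    simp only [Matrix.cons_val_zero, fejer_val_sub_val, if_neg hj'.symm, Complex.ofReal_zero,
      zero_mul, mul_zero, Finset.sum_const_zero]

theorem chirp_apply_natCast_add_half (s t : ℝ) (m : ℕ) : chirp M !₂[s, (m + 1 / 2 : ℝ), t] = 0 := by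
  have h : (Real.fourierChar ((m : ℝ) + 1 / 2) : ℂ) = -1 := by
    rw [fourierChar_add, fourierChar_natCast, one_mul, fourierChar_one_half]
  refine Finset.sum_eq_zero fun j _ => Finset.sum_eq_zero fun k _ => ?_
  simp only [Matrix.cons_val_one, Matrix.cons_val_zero, h, add_neg_cancel, zero_div, mul_zero]

end Chirp

theorem exists_orthonormal_of_not_finiteDimensional {H : Type*} [NormedAddCommGroup H]
    [InnerProductSpace ℂ H] (hH : ¬ FiniteDimensional ℂ H) (ι : Type*) [Finite ι] :
    ∃ e : ι → H, Orthonormal ℂ e := by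
  have := Fintype.ofFinite ι
  have hrank : (Fintype.card ι : Cardinal) ≤ Module.rank ℂ H :=
    Cardinal.natCast_le_aleph0.trans (not_lt.1 fun h => hH (Module.rank_lt_aleph0_iff.1 h))
  obtain ⟨f, hf⟩ := exists_linearIndependent_of_le_rank hrank
  have e : ι ≃ Fin (Fintype.card ι) := Fintype.equivFin ι
  exact ⟨_, (InnerProductSpace.gramSchmidtNormed_orthonormal hf).comp e e.injective⟩

section Counterexample

variable {M : ℕ} [NeZero M] {H : Type*} [NormedAddCommGroup H] [InnerProductSpace ℂ H]

/-- The operator with eigenvalues `0, …, M - 1` on the Fourier transform of the orthonormal family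
`e`. -/
def dftDiagOp (e : ZMod M → H) : H →L[ℂ] H :=
  diagOp ((√(M : ℝ) : ℂ)⁻¹ • ZMod.dft e) fun j => j.val

theorem dftDiagOp_apply_dft {e : ZMod M → H} (he : Orthonormal ℂ e) (j : ZMod M) :
    dftDiagOp e (ZMod.dft e j) = ((j.val : ℝ) : ℂ) • ZMod.dft e j := by
  have hM : (√(M : ℝ) : ℂ)⁻¹ ≠ 0 := by simp [NeZero.ne]
  have h := diagOp_apply_self (orthonormal_inv_sqrt_smul_dft he) (fun j => (j.val : ℝ)) j
  rw [Pi.smul_apply, map_smul, smul_comm] at h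
  exact smul_right_injective H hM h

theorem schattenNorm_diagOp_sub_diagOp_half_le {p : ℝ≥0∞} (hp : p ≠ 0) {e : ZMod M → H}
    (he : Orthonormal ℂ e) :
    schattenNorm p ((diagOp e fun m => m.val) - diagOp e fun m => m.val + 1 / 2) ≤
      ENNReal.ofReal (1 / 2) * (M : ℝ≥0∞) ^ p.toReal⁻¹ := by
  rw [diagOp_sub]
  refine (schattenNorm_diagOp_le hp he (r := 1 / 2) (by norm_num) fun m => ?_).trans_eq
    (by rw [ZMod.card])
  rw [Pi.sub_apply, sub_add_cancel_left, abs_neg, abs_of_pos one_half_pos]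

variable [CompleteSpace H]

theorem tripleFun_dftDiagOp_apply_dft {e : ZMod M → H} (he : Orthonormal ℂ e) (b : ZMod M → ℝ)
    (f : EuclideanSpace ℝ (Fin 3) → ℂ) (k : ZMod M) :
    tripleFun f (dftDiagOp e) (diagOp e b) (dftDiagOp e) (ZMod.dft e k) =
      ∑ j, (∑ m, f !₂[(j.val : ℝ), b m, (k.val : ℝ)] *
        (ZMod.stdAddChar (-(m * k)) * ((M : ℂ)⁻¹ * ZMod.stdAddChar (j * m)))) • ZMod.dft e j := by
  refine tripleFun_apply (isFiniteRankSelfAdjoint_diagOp _ _) (isFiniteRankSelfAdjoint_diagOp _ _)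
    (isFiniteRankSelfAdjoint_diagOp _ _) f (dftDiagOp_apply_dft he) (diagOp_apply_self he b)
    (dftDiagOp_apply_dft he k) (fun m => ?_) (ZMod.dft_apply e k)
  conv_lhs => rw [← ZMod.dft.symm_apply_apply e, ZMod.invDFT_apply]
  simp only [Finset.smul_sum, smul_smul]

theorem tripleFun_chirp_apply_dft {e : ZMod M → H} (he : Orthonormal ℂ e) (k : ZMod M) :
    tripleFun (chirp M) (dftDiagOp e) (diagOp e fun m => m.val) (dftDiagOp e) (ZMod.dft e k) =
      (M : ℂ) • e (-k) := by
  have hterm (j m : ZMod M) : chirp M !₂[(j.val : ℝ), (m.val : ℝ), (k.val : ℝ)] *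
      (ZMod.stdAddChar (-(m * k)) * ((M : ℂ)⁻¹ * ZMod.stdAddChar (j * m))) =
      (M : ℂ)⁻¹ * ZMod.stdAddChar (-(j * k)) := by
    rw [chirp_apply_val, mul_left_comm _ (M : ℂ)⁻¹, mul_left_comm _ (M : ℂ)⁻¹]
    simp only [← AddChar.map_add_eq_mul]
    ring_nf
  have hM : (M : ℂ) ≠ 0 := NeZero.ne _
  rw [tripleFun_dftDiagOp_apply_dft he, ← congrFun (ZMod.dft_dft e) k, ZMod.dft_apply]
  simp only [hterm, Finset.sum_const, Finset.card_univ, ZMod.card, nsmul_eq_mul,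
    mul_inv_cancel_left₀ hM]

theorem tripleFun_chirp_half_apply_dft {e : ZMod M → H} (he : Orthonormal ℂ e) (k : ZMod M) :
    tripleFun (chirp M) (dftDiagOp e) (diagOp e fun m => m.val + 1 / 2) (dftDiagOp e)
      (ZMod.dft e k) = 0 := by
  simp only [tripleFun_dftDiagOp_apply_dft he, chirp_apply_natCast_add_half, zero_mul,
    Finset.sum_const_zero, zero_smul]

theorem le_schattenNorm_tripleFun_chirp_sub {p : ℝ≥0∞} (hp : p ≠ 0) {e : ZMod M → H}
    (he : Orthonormal ℂ e) :
    ENNReal.ofReal √M * (M : ℝ≥0∞) ^ p.toReal⁻¹ ≤ schattenNorm p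
      (tripleFun (chirp M) (dftDiagOp e) (diagOp e fun m => m.val) (dftDiagOp e) -
        tripleFun (chirp M) (dftDiagOp e) (diagOp e fun m => m.val + 1 / 2) (dftDiagOp e)) := by
  have hM : (√(M : ℝ) : ℂ) ≠ 0 := by simp [NeZero.ne]
  refine (le_of_eq ?_).trans (le_schattenNorm_of_orthonormal hp (c := √(M : ℝ))
    (orthonormal_inv_sqrt_smul_dft he) (he.comp _ neg_injective) fun k => ?_)
  · rw [ZMod.card, ← ofReal_norm, Complex.norm_real, Real.norm_of_nonneg (Real.sqrt_nonneg _)]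
  · rw [Pi.smul_apply, map_smul, sub_apply, tripleFun_chirp_apply_dft he,
      tripleFun_chirp_half_apply_dft he, sub_zero, smul_smul, ← ofReal_sqrt_natCast_mul_self,
      inv_mul_cancel_left₀ hM, Function.comp_apply]

theorem exists_besovNorm_chirp_le (w : DyadicBump) :
    ∃ b : ℝ≥0∞, b ≠ ⊤ ∧ ∀ (M : ℕ) [NeZero M], ∃ T : 𝓢'(EuclideanSpace ℝ (Fin 3), ℂ),
      IsContinuousRepr (chirp M) T ∧ MemBesov w T ∧ besovNorm w T ≤ b := by
  refine ⟨_, ?_, fun M _ => exists_memBesov_of_mem_trigPolySpace w (N := 7) ?_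
    chirp_mem_trigPolySpace norm_chirp_le⟩
  · exact ENNReal.mul_ne_top (ENNReal.zpow_ne_top two_ne_zero ENNReal.ofNat_ne_top _)
      ENNReal.ofReal_ne_top
  · rw [show (2 : ℝ) ^ (7 : ℤ) / 2 = 64 by norm_num]
    linarith [Real.pi_lt_four]

end Counterexample

theorem exists_natCast_sqrt_gt {x : ℝ≥0∞} (hx : x ≠ ⊤) :
    ∃ M : ℕ, M ≠ 0 ∧ x < ENNReal.ofReal √M := by
  have h : Filter.Tendsto (fun M : ℕ => ENNReal.ofReal √M) Filter.atTop (nhds ⊤) :=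
    ENNReal.tendsto_ofReal_atTop.comp (Real.tendsto_sqrt_atTop.comp tendsto_natCast_atTop_atTop)
  exact ((Filter.eventually_ne_atTop 0).and (h.eventually_const_lt hx.lt_top)).exists

end TripleLip

end

theorem theorem4p1_general {H : Type*} [NormedAddCommGroup H] [InnerProductSpace ℂ H]
    [CompleteSpace H] (hH : ¬ FiniteDimensional ℂ H) (w : DyadicBump) (p : ℝ≥0∞) (hp : p ≠ 0) :
    ¬ ∃ K : ℝ, 0 < K ∧
      ∀ A₁ B₁ C₁ A₂ B₂ C₂ : H →L[ℂ] H,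
        IsFiniteRankSelfAdjoint A₁ → IsFiniteRankSelfAdjoint B₁ → IsFiniteRankSelfAdjoint C₁ →
        IsFiniteRankSelfAdjoint A₂ → IsFiniteRankSelfAdjoint B₂ → IsFiniteRankSelfAdjoint C₂ →
        ∀ (f : EuclideanSpace ℝ (Fin 3) → ℂ) (T : 𝓢'(EuclideanSpace ℝ (Fin 3), ℂ)),
          IsContinuousRepr f T → MemBesov w T →
          schattenNorm p (tripleFun f A₁ B₁ C₁ - tripleFun f A₂ B₂ C₂) ≤
            ENNReal.ofReal K * besovNorm w T *
              max (max (schattenNorm p (A₁ - A₂)) (schattenNorm p (B₁ - B₂)))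
                (schattenNorm p (C₁ - C₂)) := by
  rintro ⟨K, -, hK⟩
  obtain ⟨b, hb_top, hb⟩ := exists_besovNorm_chirp_le w
  have hK_top : ENNReal.ofReal K * b * ENNReal.ofReal (1 / 2) ≠ ⊤ := by finiteness
  obtain ⟨M, hM0, hM⟩ := exists_natCast_sqrt_gt hK_top
  have : NeZero M := ⟨hM0⟩
  obtain ⟨e, he⟩ := exists_orthonormal_of_not_finiteDimensional hH (ZMod M)
  obtain ⟨T, hfT, hT, hTb⟩ := hb M
  have hself {v : ZMod M → H} {a : ZMod M → ℝ} : IsFiniteRankSelfAdjoint (diagOp v a) :=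
    isFiniteRankSelfAdjoint_diagOp v a
  have hle : ENNReal.ofReal √M * (M : ℝ≥0∞) ^ p.toReal⁻¹ ≤
      ENNReal.ofReal K * b * ENNReal.ofReal (1 / 2) * (M : ℝ≥0∞) ^ p.toReal⁻¹ := by
    refine (le_schattenNorm_tripleFun_chirp_sub hp he).trans
      ((hK _ _ _ _ _ _ hself hself hself hself hself hself _ T hfT hT).trans ?_)
    rw [sub_self, schattenNorm_zero hp, max_eq_left zero_le, max_eq_right zero_le,
      mul_assoc _ (ENNReal.ofReal (1 / 2))]
    gcongr
    exact schattenNorm_diagOp_sub_diagOp_half_le hp he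
  refine hM.not_ge ((ENNReal.mul_le_mul_iff_left ?_ ?_).1 hle)
  · simp [hM0]
  · exact ENNReal.rpow_ne_top_of_nonneg (by positivity) (ENNReal.natCast_ne_top M)

theorem theorem4p1 {H : Type*} [NormedAddCommGroup H] [InnerProductSpace ℂ H] [CompleteSpace H]
    (hH : ¬ FiniteDimensional ℂ H) (w : DyadicBump) (p : ℝ≥0∞) (hp : 1 ≤ p) :
    ¬ ∃ K : ℝ, 0 < K ∧
      ∀ A₁ B₁ C₁ A₂ B₂ C₂ : H →L[ℂ] H,
        IsFiniteRankSelfAdjoint A₁ → IsFiniteRankSelfAdjoint B₁ → IsFiniteRankSelfAdjoint C₁ →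
        IsFiniteRankSelfAdjoint A₂ → IsFiniteRankSelfAdjoint B₂ → IsFiniteRankSelfAdjoint C₂ →
        ∀ (f : EuclideanSpace ℝ (Fin 3) → ℂ) (T : 𝓢'(EuclideanSpace ℝ (Fin 3), ℂ)),
          IsContinuousRepr f T → MemBesov w T →
          schattenNorm p (tripleFun f A₁ B₁ C₁ - tripleFun f A₂ B₂ C₂) ≤
            ENNReal.ofReal K * besovNorm w T *
              max (max (schattenNorm p (A₁ - A₂)) (schattenNorm p (B₁ - B₂)))
                (schattenNorm p (C₁ - C₂)) :=
  theorem4p1_general hH w p (zero_lt_one.trans_le hp).ne'
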